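/- Let $\mu$ be Lebesgue measure on $X=\mathbb{R}$ and $T(x)=x+1$. Let $K$ be a standard Borel space and $\rho$ a probability measure on $K$ that is not a Dirac mass. Let $X^*$ be the space of countable sums of Dirac masses on $\mathbb{R}$ that are finite on bounded sets, and $(X\times K)^*$ the space of countable sums of Dirac masses on $\mathbb{R}\times K$ that are finite on $B\times K$ for every bounded Borel set $B\subset\mathbb{R}$. Both carry the $\sigma$-algebra generated by the maps $\omega\mapsto\omega(A)$, $A$ measurable. Let $\mu^*$ and $(\mu\otimes\rho)^*$ be the Poisson point processes of intensity $\mu$ and $\mu\otimes\rho$: a Poisson point process of intensity $m$ is the (existing and unique) probability measure under which, for all disjoint measurable sets $A_1,\dots,A_n$ with $0<m(A_i)<\infty$, the variables $\omega(A_1),\dots,\omega(A_n)$ are independent and Poisson distributed with parameters $m(A_1),\dots,m(A_n)$. Write $f_*\omega$ for the image of $\omega$ under a map $f$, i.e. $f_*\sum_i\delta_{x_i}=\sum_i\delta_{f(x_i)}$, and let $\pi(x,\kappa)=x$. Then $\pi_*$ is a factor map from the probability measure preserving system $((X\times K)^*,(\mu\otimes\rho)^*,(T\times\mathrm{Id})_*)$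 to $(X^*,\mu^*,T_*)$, and this extension is not confined. That is, there is a probability measure $\lambda\neq(\mu\otimes\rho)^*\otimes(\mu\otimes\rho)^*$ on $(X\times K)^*\times(X\times K)^*$, invariant under $(T\times\mathrm{Id})_*\times(T\times\mathrm{Id})_*$, whose two marginals are $(\mu\otimes\rho)^*$ and whose image under $\pi_*\times\pi_*$ is $\mu^*\otimes\mu^*$. -/

import Mathlib

open MeasureTheory ProbabilityTheory
open scoped ENNReal

/-- A counting measure: a countable (possibly finite or empty) sum of Dirac masses `∑ δ_{x i}`. -/
def IsCountingMeasure {Z : Type*} [MeasurableSpace Z] (ω : Measure Z) : Prop :=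
  ∃ (ι : Type) (_ : Countable ι) (x : ι → Z), ω = Measure.sum fun i => Measure.dirac (x i)

/-- The space `Z^*` of counting measures on `Z` that are locally finite, that is, finite on the
measurable sets that are bounded for the bornology `𝓑`. -/
def CountingMeasures (Z : Type*) [MeasurableSpace Z] (𝓑 : Bornology Z) : Type _ :=
  {ω : Measure Z // IsCountingMeasure ω ∧
    ∀ B : Set Z, MeasurableSet B → @Bornology.IsBounded Z 𝓑 B → ω B < ∞}

/-- The `σ`-algebra of `Z^*`: the restriction of the one on measures on `Z` that is generated by
the maps `ω ↦ ω A` with `A` measurable. -/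
instance CountingMeasures.instMeasurableSpace (Z : Type*) [MeasurableSpace Z] (𝓑 : Bornology Z) :
    MeasurableSpace (CountingMeasures Z 𝓑) :=
  inferInstanceAs (MeasurableSpace {ω : Measure Z // IsCountingMeasure ω ∧
    ∀ B : Set Z, MeasurableSet B → @Bornology.IsBounded Z 𝓑 B → ω B < ∞})

theorem IsCountingMeasure.map {Z W : Type*} [MeasurableSpace Z] [MeasurableSpace W]
    {ω : Measure Z} (h : IsCountingMeasure ω) {f : Z → W} (hf : Measurable f) :
    IsCountingMeasure (ω.map f) := by
  obtain ⟨ι, hι, x, rfl⟩ := h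
  refine ⟨ι, hι, fun i => f (x i), ?_⟩
  rw [Measure.map_sum hf.aemeasurable]
  simp only [Measure.map_dirac' hf]

/-- The map `f_* : Z^* → W^*`, `∑ δ_{x i} ↦ ∑ δ_{f (x i)}`, that is, the image measure, for a
measurable map `f : Z → W` under which preimages of bounded sets are bounded. -/
noncomputable def CountingMeasures.map {Z W : Type*} [MeasurableSpace Z] [MeasurableSpace W]
    {𝓑 : Bornology Z} {𝓒 : Bornology W} (f : Z → W) (hf : Measurable f)
    (hb : ∀ B : Set W, @Bornology.IsBounded W 𝓒 B → @Bornology.IsBounded Z 𝓑 (f ⁻¹' B))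
    (ω : CountingMeasures Z 𝓑) : CountingMeasures W 𝓒 :=
  ⟨ω.1.map f, ω.2.1.map hf, fun B hBm hB => by
    rw [Measure.map_apply hf hBm]
    exact ω.2.2 _ (hf hBm) (hb B hB)⟩

/-- `P` is the law of the Poisson point process of intensity `μ` on `Z^*`: for disjoint measurable
sets `A i` with `0 < μ (A i) < ∞`, the random variables `ω ↦ ω (A i)` are independent, and
`ω (A i)` has the Poisson law of parameter `μ (A i)`. -/
def IsPoissonProcess {Z : Type*} [MeasurableSpace Z] {𝓑 : Bornology Z} (μ : Measure Z)
    (P : Measure (CountingMeasures Z 𝓑)) : Prop :=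
  IsProbabilityMeasure P ∧
  ∀ (n : ℕ) (A : Fin n → Set Z), (∀ i, MeasurableSet (A i)) →
    (∀ i j, i ≠ j → Disjoint (A i) (A j)) → (∀ i, 0 < μ (A i) ∧ μ (A i) < ∞) →
      iIndepFun (fun i (ω : CountingMeasures Z 𝓑) => ω.1 (A i)) P ∧
      ∀ i, P.map (fun ω => ω.1 (A i)) =
        (poissonMeasure (μ (A i)).toNNReal).map (fun k : ℕ => (k : ℝ≥0∞))

/-- `T` is an invertible (with measurable inverse) transformation that preserves the probability
measure `μ`. -/
structure IsPMPSystem {X : Type*} [MeasurableSpace X] (μ : Measure X) (T : X → X) : Prop where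
  isProbabilityMeasure : IsProbabilityMeasure μ
  measurePreserving : MeasurePreserving T μ μ
  invertible : ∃ S : X → X, Measurable S ∧ Function.LeftInverse S T ∧ Function.RightInverse S T

/-- `π` is a factor map from the probability measure preserving system `(X, μ, T)` to the
probability measure preserving system `(Y, ν, S)`; so it defines an extension. -/
structure IsExtension {X Y : Type*} [MeasurableSpace X] [MeasurableSpace Y]
    (μ : Measure X) (T : X → X) (ν : Measure Y) (S : Y → Y) (π : X → Y) : Prop where
  source : IsPMPSystem μ T
  target : IsPMPSystem ν S
  measurePreserving : MeasurePreserving π μ ν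
  equivariant : ∀ᵐ x ∂μ, π (T x) = S (π x)

/-- The extension `π : (X, μ, T) → (Y, ν, S)` is confined: the only self-joining of `(X, μ, T)`
whose image under `π × π` is `ν ⊗ ν` is `μ ⊗ μ`. -/
def IsConfined {X Y : Type*} [MeasurableSpace X] [MeasurableSpace Y]
    (μ : Measure X) (T : X → X) (ν : Measure Y) (S : Y → Y) (π : X → Y) : Prop :=
  IsExtension μ T ν S π ∧
  ∀ l : Measure (X × X), IsProbabilityMeasure l →
    MeasurePreserving (Prod.map T T) l l →
    l.map Prod.fst = μ → l.map Prod.snd = μ →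
    l.map (Prod.map π π) = ν.prod ν →
    l = μ.prod μ

/-- `ℝ^*`: counting measures on `ℝ` that are finite on bounded sets. -/
abbrev RealConfig : Type := CountingMeasures ℝ inferInstance

/-- `(ℝ × K)^*`: counting measures on `ℝ × K` that are finite on `B × K` for bounded `B ⊆ ℝ`. -/
abbrev MarkedConfig (K : Type*) [MeasurableSpace K] : Type _ :=
  CountingMeasures (ℝ × K) (Bornology.induced Prod.fst)

/-- The translation `T x = x + 1`. -/
def translation (x : ℝ) : ℝ := x + 1

theorem measurable_translation : Measurable translation := measurable_id.add_const 1

theorem isBounded_preimage_translation (B : Set ℝ) (hB : Bornology.IsBounded B) :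
    Bornology.IsBounded (translation ⁻¹' B) := by
  obtain ⟨R, hR⟩ := hB.subset_closedBall 0
  refine (Metric.isBounded_closedBall (x := (0 : ℝ)) (r := R + 1)).subset fun x hx => ?_
  have h := hR hx
  simp only [translation, Metric.mem_closedBall, dist_zero_right, Real.norm_eq_abs] at h ⊢
  rw [abs_le] at h ⊢
  constructor <;> linarith [h.1, h.2]

/-- `T_*` on `ℝ^*`, where `T x = x + 1`. -/
noncomputable def translationSuspension : RealConfig → RealConfig :=
  CountingMeasures.map translation measurable_translation isBounded_preimage_translation

/-- `(T × Id)_*` on `(ℝ × K)^*`, where `T x = x + 1`. -/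
noncomputable def markedTranslationSuspension (K : Type*) [MeasurableSpace K] :
    MarkedConfig K → MarkedConfig K :=
  CountingMeasures.map (Prod.map translation id) (measurable_translation.prodMap measurable_id)
    (fun B hB => by
      rw [Bornology.isBounded_induced] at hB ⊢
      refine (isBounded_preimage_translation _ hB).subset ?_
      rintro _ ⟨p, hp, rfl⟩
      exact ⟨_, hp, rfl⟩)

/-- `π_* : (ℝ × K)^* → ℝ^*`, where `π (x, k) = x`: forgetting the marks. -/
noncomputable def forgetMarks (K : Type*) [MeasurableSpace K] : MarkedConfig K → RealConfig :=
  CountingMeasures.map Prod.fst measurable_fst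
    (fun B hB => by
      rw [Bornology.isBounded_induced]
      exact hB.subset (Set.image_preimage_subset _ _))

open Filter Topology

/-! The marked process can be sampled cell by cell: each interval `[n, n + 1)` receives a Poisson(1)
number of points with i.i.d. uniform positions, and the `j`-th point of cell `n` carries the entry
`(n, j)` of an i.i.d. array of marks of law `ρ`. The joining takes two independent samples of
positions but uses the same array of marks for both (`sharedMarksJoining`). Each coordinate alone is
the marked process. Forgetting the marks leaves two independent samples, so the projection is a
product. The unit translation permutes the cells, hence only shifts the index `n` in positions and
marks, and the i.i.d. laws do not see this.

The joining is not the product: since `ρ` is not a Dirac mass, some `B` has `ρ B` and `ρ Bᶜ`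
positive. With positive probability under the product, the first configuration is nonempty over `[0,
1)` with all its marks there in `B`, and the second likewise with `Bᶜ`. With shared marks this would
put the entry `(0, 0)` in both `B` and `Bᶜ` (`sharedMarksJoining_ne_prod`).

That the cell construction is Poisson follows from its characteristic functional
(`integral_exp_pointMeasure`). `IsPoissonProcess.unique` identifies the laws, and with
`IsPoissonProcess.map` it gives invariance under the suspensions. -/

theorem ProbabilityTheory.lintegral_natCast_poissonMeasure_lt_top (r : NNReal) :
    ∫⁻ k : ℕ, (k : ℝ≥0∞) ∂poissonMeasure r < ∞ := by
  have h : Integrable (fun k : ℕ => (k : ℝ)) (poissonMeasure r) := by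
    rw [integrable_poissonMeasure_iff]
    -- The bound `n ≤ 2 ^ n` absorbs the extra factor `n` into the exponential series at `2 * r`.
    refine Summable.of_nonneg_of_le (fun n => by positivity) (fun n => ?_)
      ((Real.summable_pow_div_factorial (2 * r)).mul_left (Real.exp (-r)))
    have h2 : (n : ℝ) ≤ 2 ^ n := by exact_mod_cast Nat.lt_two_pow_self.le
    rw [Real.norm_of_nonneg (Nat.cast_nonneg n), mul_pow, mul_div_assoc, mul_assoc]
    have : (r : ℝ) ^ n / n.factorial * n ≤ r ^ n / n.factorial * 2 ^ n := by gcongr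
    calc _ ≤ Real.exp (-r) * (r ^ n / n.factorial * 2 ^ n) := by gcongr
      _ = _ := by ring
  have := h.lintegral_lt_top
  simpa using this

/-! ### Point measures built from independent Poisson samples -/

/-- The point measure with `(w i).1` atoms `f i ((w i).2 j)`, `j < (w i).1`, for each `i`. -/
noncomputable def pointMeasure {ι Y Z : Type*} [MeasurableSpace Z] (f : ι → Y → Z)
    (w : ι → ℕ × (ℕ → Y)) : Measure Z :=
  Measure.sum fun a : Σ i, Fin (w i).1 => Measure.dirac (f a.1 ((w a.1).2 a.2))

theorem isCountingMeasure_pointMeasure {ι : Type} {Y Z : Type*} [Countable ι] [MeasurableSpace Z]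
    (f : ι → Y → Z) (w : ι → ℕ × (ℕ → Y)) : IsCountingMeasure (pointMeasure f w) :=
  ⟨_, inferInstance, _, rfl⟩

theorem pointMeasure_apply {ι Y Z : Type*} [MeasurableSpace Z] (f : ι → Y → Z)
    (w : ι → ℕ × (ℕ → Y)) {A : Set Z} (hA : MeasurableSet A) :
    pointMeasure f w A =
      ∑' i, ∑ j ∈ Finset.range (w i).1, A.indicator (1 : Z → ℝ≥0∞) (f i ((w i).2 j)) := by
  rw [pointMeasure, Measure.sum_apply _ hA]
  refine (ENNReal.tsum_sigma fun i (j : Fin (w i).1) =>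
    Measure.dirac (f i ((w i).2 j)) A).trans ?_
  refine tsum_congr fun i => ?_
  rw [tsum_fintype, Finset.sum_range]
  simp only [Measure.dirac_apply' _ hA]

/-- The law of independent samples, indexed by `ι`, each made of a Poisson variable of parameter `1`
and an independent sequence of independent points of law `ν`. -/
noncomputable def sampleLaw (ι : Type*) {Y : Type*} [MeasurableSpace Y] (ν : Measure Y) :
    Measure (ι → ℕ × (ℕ → Y)) :=
  Measure.infinitePi fun _ => (poissonMeasure 1).prod (Measure.infinitePi fun _ => ν)

instance {ι Y : Type*} [MeasurableSpace Y] (ν : Measure Y) [IsProbabilityMeasure ν] :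
    IsProbabilityMeasure (sampleLaw ι ν) := by
  unfold sampleLaw; infer_instance

theorem measurable_sum_range {Y M : Type*} [MeasurableSpace Y] [AddCommMonoid M]
    [MeasurableSpace M] [MeasurableAdd₂ M] {g : Y → M} (hg : Measurable g) :
    Measurable fun p : ℕ × (ℕ → Y) => ∑ j ∈ Finset.range p.1, g (p.2 j) :=
  measurable_from_prod_countable_right fun k => by
    simp only
    fun_prop

theorem measurable_prod_range {Y M : Type*} [MeasurableSpace Y] [CommMonoid M]
    [MeasurableSpace M] [MeasurableMul₂ M] {g : Y → M} (hg : Measurable g) :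
    Measurable fun p : ℕ × (ℕ → Y) => ∏ j ∈ Finset.range p.1, g (p.2 j) :=
  measurable_from_prod_countable_right fun k => by
    simp only
    fun_prop

section

variable {ι Y Z : Type*} [MeasurableSpace Y] [MeasurableSpace Z] {f : ι → Y → Z}

theorem measurable_pointMeasure [Countable ι] (hf : ∀ i, Measurable (f i)) : Measurable (pointMeasure f) := by
  refine Measure.measurable_of_measurable_coe _ fun A hA => ?_
  simp only [pointMeasure_apply f _ hA]
  refine Measurable.tsum fun i => ?_
  have : Measurable fun y => A.indicator (1 : Z → ℝ≥0∞) (f i y) :=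
    (measurable_one.indicator hA).comp (hf i)
  exact (measurable_sum_range this).comp (measurable_pi_apply i)

variable {ν : Measure Y} [IsProbabilityMeasure ν]

/-- Wald's identity, by conditioning on the number of terms. The Poisson mean is left unevaluated
because only its finiteness is needed. -/
theorem lintegral_sum_range {g : Y → ℝ≥0∞} (hg : Measurable g) :
    ∫⁻ p, ∑ j ∈ Finset.range p.1, g (p.2 j)
        ∂(poissonMeasure 1).prod (Measure.infinitePi fun _ : ℕ => ν) =
      (∫⁻ k : ℕ, (k : ℝ≥0∞) ∂poissonMeasure 1) * ∫⁻ y, g y ∂ν := by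
  rw [lintegral_prod _ (measurable_sum_range hg).aemeasurable, ← lintegral_mul_const _ (by fun_prop)]
  refine lintegral_congr fun k => ?_
  have h (j : ℕ) : ∫⁻ x : ℕ → Y, g (x j) ∂Measure.infinitePi (fun _ => ν) = ∫⁻ y, g y ∂ν :=
    (measurePreserving_eval_infinitePi (fun _ : ℕ => ν) j).lintegral_comp hg
  change ∫⁻ x : ℕ → Y, ∑ j ∈ Finset.range k, g (x j) ∂Measure.infinitePi (fun _ => ν) = _
  rw [lintegral_finsetSum _ (fun j _ => by fun_prop)]
  simp [h]

theorem lintegral_pointMeasure [Countable ι] (hf : ∀ i, Measurable (f i)) {A : Set Z} (hA : MeasurableSet A) :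
    ∫⁻ w, pointMeasure f w A ∂sampleLaw ι ν =
      (∫⁻ k : ℕ, (k : ℝ≥0∞) ∂poissonMeasure 1) * Measure.sum (fun i => ν.map (f i)) A := by
  have hm (i : ι) : Measurable fun y => A.indicator (1 : Z → ℝ≥0∞) (f i y) :=
    (measurable_one.indicator hA).comp (hf i)
  simp only [pointMeasure_apply f _ hA]
  have hs (i : ι) : Measurable fun w : ι → ℕ × (ℕ → Y) =>
      ∑ j ∈ Finset.range (w i).1, A.indicator (1 : Z → ℝ≥0∞) (f i ((w i).2 j)) :=
    (measurable_sum_range (hm i)).comp (measurable_pi_apply i)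
  rw [lintegral_tsum fun i => (hs i).aemeasurable, Measure.sum_apply _ hA, ← ENNReal.tsum_mul_left]
  refine tsum_congr fun i => ?_
  rw [← lintegral_indicator_one hA, lintegral_map (measurable_one.indicator hA) (hf i),
    ← lintegral_sum_range (hm i)]
  exact (measurePreserving_eval_infinitePi
    (fun _ : ι => (poissonMeasure 1).prod (Measure.infinitePi fun _ : ℕ => ν)) i).lintegral_comp
    (measurable_sum_range (hm i))

theorem ae_pointMeasure_lt_top [Countable ι] (hf : ∀ i, Measurable (f i)) {A : Set Z} (hA : MeasurableSet A)
    (h : Measure.sum (fun i => ν.map (f i)) A < ∞) :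
    ∀ᵐ w ∂sampleLaw ι ν, pointMeasure f w A < ∞ := by
  refine ae_lt_top ((Measure.measurable_coe hA).comp (measurable_pointMeasure hf)) ?_
  rw [lintegral_pointMeasure hf hA]
  exact (ENNReal.mul_lt_top (lintegral_natCast_poissonMeasure_lt_top 1) h).ne

/-- Given the count `k`, independence yields `(∫ g) ^ k`; averaging over `k` is the generating
function `exp (z - 1)` of Poisson(1) at `z = ∫ g`. -/
theorem integral_prod_range {g : Y → ℂ} (hg : Measurable g) (hg1 : ∀ y, ‖g y‖ ≤ 1) :
    ∫ p, ∏ j ∈ Finset.range p.1, g (p.2 j)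
        ∂(poissonMeasure 1).prod (Measure.infinitePi fun _ : ℕ => ν) =
      Complex.exp (∫ y, (g y - 1) ∂ν) := by
  have hgi : Integrable g ν := .of_bound hg.aestronglyMeasurable 1 (ae_of_all _ hg1)
  have hbd (p : ℕ × (ℕ → Y)) : ‖∏ j ∈ Finset.range p.1, g (p.2 j)‖ ≤ 1 := by
    rw [norm_prod]
    exact Finset.prod_le_one (fun _ _ => norm_nonneg _) fun _ _ => hg1 _
  rw [integral_prod _ (.of_bound (measurable_prod_range hg).aestronglyMeasurable 1
    (ae_of_all _ hbd))]
  have h (k : ℕ) : ∫ x : ℕ → Y, ∏ j ∈ Finset.range k, g (x j) ∂Measure.infinitePi (fun _ => ν) =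
      (∫ y, g y ∂ν) ^ k := by
    have h1 := integral_restrict_infinitePi (μ := fun _ : ℕ => ν) (s := Finset.range k)
      (f := fun x => ∏ j, g (x j)) (Measurable.aestronglyMeasurable <|
        Finset.measurable_fun_prod _ fun j _ => hg.comp (measurable_pi_apply j))
    rw [integral_fintype_prod_eq_pow] at h1
    rw [Fintype.card_coe, Finset.card_range] at h1
    rw [← h1]
    exact integral_congr_ae (ae_of_all _ fun x =>
      (Finset.prod_coe_sort (Finset.range k) (fun j => g (x j))).symm)
  simp only [h]
  rw [integral_poissonMeasure, integral_sub hgi (integrable_const _)]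
  simp only [NNReal.coe_one, one_pow, mul_one, integral_const, probReal_univ, one_smul, Complex.exp_sub, Complex.real_smul]
  have hexp (z : ℂ) : Complex.exp z = ∑' n : ℕ, z ^ n / n.factorial := by
    rw [Complex.exp_eq_exp_ℂ, NormedSpace.exp_eq_tsum_div]
  rw [hexp (∫ y, g y ∂ν), div_eq_inv_mul, ← tsum_mul_left]
  refine tsum_congr fun n => ?_
  push_cast
  rw [Complex.exp_neg]
  ring

theorem integral_prod_prod_range {g : ι → Y → ℂ} (hg : ∀ i, Measurable (g i))
    (hg1 : ∀ i y, ‖g i y‖ ≤ 1) (s : Finset ι) :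
    ∫ w, ∏ i ∈ s, ∏ j ∈ Finset.range (w i).1, g i ((w i).2 j) ∂sampleLaw ι ν =
      Complex.exp (∑ i ∈ s, ∫ y, (g i y - 1) ∂ν) := by
  have h1 := integral_restrict_infinitePi
    (μ := fun _ : ι => (poissonMeasure 1).prod (Measure.infinitePi fun _ : ℕ => ν)) (s := s)
    (f := fun x => ∏ i, ∏ j ∈ Finset.range (x i).1, g i ((x i).2 j))
    (Measurable.aestronglyMeasurable <| Finset.measurable_fun_prod _ fun i _ =>
      (measurable_prod_range (hg i)).comp (measurable_pi_apply i))
  rw [integral_fintype_prod_eq_prod (μ := fun _ => (poissonMeasure 1).prod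
    (Measure.infinitePi fun _ : ℕ => ν))
    (f := fun (i : s) (p : ℕ × (ℕ → Y)) => ∏ j ∈ Finset.range p.1, g i (p.2 j))] at h1
  simp only [integral_prod_range (hg _) (hg1 _)] at h1
  rw [Finset.prod_coe_sort s (fun i => Complex.exp (∫ y, (g i y - 1) ∂ν)), ← Complex.exp_sum] at h1
  rw [← h1, sampleLaw]
  refine integral_congr_ae (ae_of_all _ fun w => ?_)
  exact (Finset.prod_coe_sort s (fun i => ∏ j ∈ Finset.range (w i).1, g i ((w i).2 j))).symm

end

/-! ### Characteristic functional and joint law of the counts -/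

section

variable {ι Y Z : Type*} [MeasurableSpace Y] [MeasurableSpace Z] {f : ι → Y → Z}
  {ν : Measure Y} [IsProbabilityMeasure ν]

theorem hasSum_toReal_pointMeasure {Y : Type*} {f : ι → Y → Z} {w : ι → ℕ × (ℕ → Y)} {A : Set Z} (hA : MeasurableSet A)
    (h : pointMeasure f w A < ∞) :
    HasSum (fun i => ∑ j ∈ Finset.range (w i).1, A.indicator (1 : Z → ℝ) (f i ((w i).2 j)))
      (pointMeasure f w A).toReal := by
  rw [pointMeasure_apply f w hA] at h ⊢
  convert ENNReal.hasSum_toReal h.ne using 1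
  swap
  · exact ENNReal.tsum_toReal_eq (ENNReal.ne_top_of_tsum_ne_top h.ne)
  funext i
  rw [ENNReal.toReal_sum fun j _ => by by_cases h : f i ((w i).2 j) ∈ A <;> simp [h]]
  refine Finset.sum_congr rfl fun j _ => ?_
  by_cases h : f i ((w i).2 j) ∈ A <;> simp [h]

/-- By disjointness at most one indicator is nonzero at `z`. This is what separates the sets in the
characteristic functional, and so gives independence of the counts. -/
theorem Complex.exp_sum_indicator_sub_one {Z κ : Type*} [Fintype κ] {A : κ → Set Z}
    (hd : Pairwise (Function.onFun Disjoint A)) (t : κ → ℝ) (z : Z) :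
    Complex.exp (∑ l, (A l).indicator (1 : Z → ℝ) z * t l * Complex.I) - 1 =
      ∑ l, (A l).indicator (fun _ => Complex.exp (t l * Complex.I) - 1) z := by
  by_cases h : ∃ l, z ∈ A l
  · obtain ⟨l, hl⟩ := h
    have h0 (k : κ) (hk : k ≠ l) : z ∉ A k := fun hz => Set.disjoint_left.1 (hd hk) hz hl
    rw [Finset.sum_eq_single l (fun k _ hk => by simp [h0 k hk]) (by simp),
      Finset.sum_eq_single l (fun k _ hk => by simp [h0 k hk]) (by simp)]
    simp [hl]
  · push Not at h
    simp [h]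

/-- The characteristic functional of the superposition of Poisson samples. -/
theorem integral_exp_pointMeasure [Countable ι] (hf : ∀ i, Measurable (f i)) {κ : Type*}
    [Fintype κ] {A : κ → Set Z} (hA : ∀ l, MeasurableSet (A l))
    (hd : Pairwise (Function.onFun Disjoint A))
    (hfin : ∀ l, Measure.sum (fun i => ν.map (f i)) (A l) < ∞) (t : κ → ℝ) :
    ∫ w, Complex.exp (∑ l, (pointMeasure f w (A l)).toReal * t l * Complex.I) ∂sampleLaw ι ν =
      Complex.exp (∑ l, (Measure.sum (fun i => ν.map (f i)) (A l)).toReal *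
        (Complex.exp (t l * Complex.I) - 1)) := by
  set m := Measure.sum (fun i => ν.map (f i)) with hm
  set φ : Z → ℂ := fun z => ∑ l, (((A l).indicator (1 : Z → ℝ) z : ℝ) : ℂ) * t l * Complex.I with hφ
  have hφm : Measurable φ := Finset.measurable_fun_sum _ fun l _ =>
    ((Complex.measurable_ofReal.comp (measurable_one.indicator (hA l))).mul_const _).mul_const _
  have hφn (z : Z) : ‖Complex.exp (φ z)‖ = 1 := by
    have : φ z = ((∑ l, (A l).indicator (1 : Z → ℝ) z * t l : ℝ) : ℂ) * Complex.I := by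
      rw [hφ]; push_cast; rw [Finset.sum_mul]
    rw [this, Complex.norm_exp_ofReal_mul_I]
  have hind (l : κ) : Integrable
      ((A l).indicator fun _ => Complex.exp (t l * Complex.I) - 1) m := by
    rw [integrable_indicator_iff (hA l)]
    exact integrableOn_const (hfin l).ne
  have hint : Integrable (fun z => Complex.exp (φ z) - 1) m := by
    simp only [hφ, Complex.exp_sum_indicator_sub_one hd]
    exact integrable_finsetSum _ fun l _ => hind l
  have hval : ∫ z, (Complex.exp (φ z) - 1) ∂m =
      ∑ l, (m (A l)).toReal * (Complex.exp (t l * Complex.I) - 1) := by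
    simp only [hφ, Complex.exp_sum_indicator_sub_one hd]
    rw [integral_finsetSum _ fun l _ => hind l]
    refine Finset.sum_congr rfl fun l _ => ?_
    rw [integral_indicator_const _ (hA l), Complex.real_smul]
    rfl
  -- Truncate to finitely many samples, where independence gives an explicit integral. The products
  -- have modulus 1 and converge almost surely because the counts are almost surely finite, so
  -- dominated convergence applies.
  have hlim : Tendsto (fun s : Finset ι => ∫ w, ∏ i ∈ s, ∏ j ∈ Finset.range (w i).1,
      Complex.exp (φ (f i ((w i).2 j))) ∂sampleLaw ι ν) atTop
      (𝓝 (∫ w, Complex.exp (∑ l, (pointMeasure f w (A l)).toReal * t l * Complex.I)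
        ∂sampleLaw ι ν)) := by
    refine tendsto_integral_filter_of_dominated_convergence (fun _ => 1)
      (.of_forall fun s => ?_) (.of_forall fun s => ae_of_all _ fun w => ?_)
      (integrable_const _) ?_
    · refine (Finset.measurable_fun_prod _ fun i _ => ?_).aestronglyMeasurable
      exact (measurable_prod_range
        (g := fun y => Complex.exp (φ (f i y)))
        (Complex.measurable_exp.comp (hφm.comp (hf i)))).comp (measurable_pi_apply i)
    · simp [norm_prod, hφn]
    · filter_upwards [ae_all_iff.2 fun l => ae_pointMeasure_lt_top (ν := ν) hf (hA l) (hfin l)]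
        with w hw
      simp only [← Complex.exp_sum]
      refine (Complex.continuous_exp.tendsto _).comp ?_
      have h1 := hasSum_sum (s := Finset.univ) fun l _ =>
        (((Complex.hasSum_ofReal.2 (hasSum_toReal_pointMeasure (hA l) (hw l))).mul_right
          (t l : ℂ)).mul_right Complex.I)
      refine Tendsto.congr (fun s => Finset.sum_congr rfl fun i _ => ?_) h1
      simp only [hφ]
      rw [Finset.sum_comm]
      push_cast
      simp only [Finset.sum_mul]
  refine tendsto_nhds_unique hlim ?_
  have hg (i : ι) : Measurable fun y => Complex.exp (φ (f i y)) :=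
    Complex.measurable_exp.comp (hφm.comp (hf i))
  simp only [integral_prod_prod_range hg (fun i y => (hφn _).le)]
  rw [← hval]
  refine (Complex.continuous_exp.tendsto _).comp ?_
  refine (hasSum_integral_measure hint).congr fun s => Finset.sum_congr rfl fun i _ => ?_
  exact integral_map (hf i).aemeasurable
    ((Complex.measurable_exp.comp hφm).sub_const 1).aestronglyMeasurable

/-- The characteristic function factors into Poisson ones. Counts are taken in `ℝ` so that they form
a vector in a Euclidean space; `map_pointMeasure` returns to `ℝ≥0∞`, losing nothing since they are
almost surely finite. -/
theorem map_toReal_pointMeasure [Countable ι] (hf : ∀ i, Measurable (f i)) {κ : Type*}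
    [Fintype κ] {A : κ → Set Z} (hA : ∀ l, MeasurableSet (A l))
    (hd : Pairwise (Function.onFun Disjoint A))
    (hfin : ∀ l, Measure.sum (fun i => ν.map (f i)) (A l) < ∞) :
    (sampleLaw ι ν).map (fun w l => (pointMeasure f w (A l)).toReal) =
      Measure.pi fun l => (poissonMeasure (Measure.sum (fun i => ν.map (f i)) (A l)).toNNReal).map
        (fun k : ℕ => (k : ℝ)) := by
  have hm (l : κ) : Measurable fun w => (pointMeasure f w (A l)).toReal :=
    ((Measure.measurable_coe (hA l)).comp (measurable_pointMeasure hf)).ennreal_toReal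
  have : IsProbabilityMeasure
      ((sampleLaw ι ν).map (fun w l => (pointMeasure f w (A l)).toReal)) :=
    Measure.isProbabilityMeasure_map (measurable_pi_lambda _ hm).aemeasurable
  refine charFun_eq_pi_iff.1 fun t => ?_
  simp only [charFun_map_cast_poissonMeasure]
  rw [← Complex.exp_sum, Measure.map_map (by fun_prop) (measurable_pi_lambda _ hm), charFun_apply,
    integral_map ((WithLp.measurable_toLp _ _).comp (measurable_pi_lambda _ hm)).aemeasurable
      (by fun_prop)]
  convert integral_exp_pointMeasure hf hA hd hfin t.ofLp using 3 with w
  simp only [Function.comp_apply, PiLp.inner_apply, Real.inner_apply]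
  push_cast
  · rw [Finset.sum_mul]
  · rfl

theorem map_pointMeasure [Countable ι] (hf : ∀ i, Measurable (f i)) {κ : Type*}
    [Fintype κ] {A : κ → Set Z} (hA : ∀ l, MeasurableSet (A l))
    (hd : Pairwise (Function.onFun Disjoint A))
    (hfin : ∀ l, Measure.sum (fun i => ν.map (f i)) (A l) < ∞) :
    (sampleLaw ι ν).map (fun w l => pointMeasure f w (A l)) =
      Measure.pi fun l => (poissonMeasure (Measure.sum (fun i => ν.map (f i)) (A l)).toNNReal).map
        (fun k : ℕ => (k : ℝ≥0∞)) := by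
  have hm (l : κ) : Measurable fun w => (pointMeasure f w (A l)).toReal :=
    ((Measure.measurable_coe (hA l)).comp (measurable_pointMeasure hf)).ennreal_toReal
  have h := congrArg (Measure.map fun (x : κ → ℝ) l => ENNReal.ofReal (x l))
    (map_toReal_pointMeasure (ν := ν) hf hA hd hfin)
  rw [Measure.map_map (by fun_prop) (measurable_pi_lambda _ hm),
    Measure.pi_map_pi (fun l => by fun_prop)] at h
  convert h using 1
  · refine Measure.map_congr ?_
    filter_upwards [ae_all_iff.2 fun l => ae_pointMeasure_lt_top (ν := ν) hf (hA l) (hfin l)]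
      with w hw
    funext l
    simp [(hw l).ne]
  · congr with l : 1
    rw [Measure.map_map (by fun_prop) (by fun_prop)]
    congr with k
    simp

end

/-- A random configuration whose underlying measure is a superposition of Poisson samples is
a Poisson process. -/
theorem isPoissonProcess_map_of_coe_eq_pointMeasure {ι Y Z : Type*} [Countable ι]
    [MeasurableSpace Y] [MeasurableSpace Z] {𝓑 : Bornology Z} {f : ι → Y → Z}
    (hf : ∀ i, Measurable (f i)) (ν : Measure Y) [IsProbabilityMeasure ν]
    {Φ : (ι → ℕ × (ℕ → Y)) → CountingMeasures Z 𝓑} (hΦ : ∀ w, (Φ w).1 = pointMeasure f w) :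
    IsPoissonProcess (Measure.sum fun i => ν.map (f i)) ((sampleLaw ι ν).map Φ) := by
  have hΦm : Measurable Φ := by
    refine Measurable.subtype_mk (f := fun w => (Φ w).1) ?_
    simp only [hΦ]
    exact measurable_pointMeasure hf
  have : IsProbabilityMeasure ((sampleLaw ι ν).map Φ) :=
    Measure.isProbabilityMeasure_map hΦm.aemeasurable
  refine ⟨this, fun n A hA hd hfin => ?_⟩
  have hev (l : Fin n) : Measurable fun ω : CountingMeasures Z 𝓑 => ω.1 (A l) :=
    (Measure.measurable_coe (hA l)).comp measurable_subtype_coe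
  have hlaw := map_pointMeasure (ν := ν) hf hA (fun i j h => hd i j h) (fun l => (hfin l).2)
  have hlaw' : ((sampleLaw ι ν).map Φ).map (fun ω l => ω.1 (A l)) =
      Measure.pi fun l => (poissonMeasure (Measure.sum (fun i => ν.map (f i)) (A l)).toNNReal).map
        (fun k : ℕ => (k : ℝ≥0∞)) := by
    rw [Measure.map_map (measurable_pi_lambda _ hev) hΦm, ← hlaw]
    simp only [Function.comp_def, hΦ]
  have hmarg (l : Fin n) : ((sampleLaw ι ν).map Φ).map (fun ω => ω.1 (A l)) =
      (poissonMeasure (Measure.sum (fun i => ν.map (f i)) (A l)).toNNReal).map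
        (fun k : ℕ => (k : ℝ≥0∞)) := by
    have := congrArg (Measure.map (Function.eval l)) hlaw'
    rwa [Measure.map_map (measurable_pi_apply l) (measurable_pi_lambda _ hev),
      (measurePreserving_eval _ l).map_eq] at this
  refine ⟨?_, hmarg⟩
  rw [iIndepFun_iff_map_fun_eq_pi_map fun l => (hev l).aemeasurable, hlaw']
  simp only [hmarg]

/-! ### Uniqueness of the Poisson process -/

section

variable {Z : Type*} [MeasurableSpace Z] {𝓑 : Bornology Z}

theorem CountingMeasures.measurable_apply {A : Set Z} (hA : MeasurableSet A) :
    Measurable fun ω : CountingMeasures Z 𝓑 => ω.1 A :=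
  (Measure.measurable_coe hA).comp measurable_subtype_coe

theorem CountingMeasures.instMeasurableSpace_eq_comap :
    CountingMeasures.instMeasurableSpace Z 𝓑 = MeasurableSpace.comap
      (fun ω (A : {A : Set Z // MeasurableSet A}) => ω.1 A.1) MeasurableSpace.pi := by
  refine le_antisymm ?_ (measurable_pi_lambda _ fun A => measurable_apply A.2).comap_le
  refine Measurable.comap_le (m₁ := MeasurableSpace.comap
      (fun (ω : CountingMeasures Z 𝓑) (A : {A : Set Z // MeasurableSet A}) => ω.1 A.1)
      MeasurableSpace.pi) (Measure.measurable_of_measurable_coe _ fun A hA => ?_)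
  exact (measurable_pi_apply (X := fun _ => ℝ≥0∞)
    (⟨A, hA⟩ : {A : Set Z // MeasurableSet A})).comp (comap_measurable _)

/-- A finite measure on the space of configurations is determined by the joint laws of the
numbers of points in finitely many sets. -/
theorem CountingMeasures.measure_ext {P₁ P₂ : Measure (CountingMeasures Z 𝓑)} [IsFiniteMeasure P₁]
    (h : ∀ (I : Finset {A : Set Z // MeasurableSet A}),
      P₁.map (fun ω (A : I) => ω.1 A.1.1) = P₂.map fun ω (A : I) => ω.1 A.1.1) : P₁ = P₂ := by
  set ev : CountingMeasures Z 𝓑 → {A : Set Z // MeasurableSet A} → ℝ≥0∞ :=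
    fun ω A => ω.1 A.1
  have hev : Measurable ev := measurable_pi_lambda _ fun A => measurable_apply A.2
  have key : P₁.map ev = P₂.map ev := by
    have h1 := isProjectiveLimit_map (X := fun A ω => ev ω A) (P := P₁) hev.aemeasurable
    have h2 := isProjectiveLimit_map (X := fun A ω => ev ω A) (P := P₂) hev.aemeasurable
    refine h1.unique fun I => ?_
    rw [h2 I]
    exact (h I).symm
  ext E hE
  rw [instMeasurableSpace_eq_comap] at hE
  obtain ⟨G, hG, rfl⟩ := hE
  rw [← Measure.map_apply hev hG, key, Measure.map_apply hev hG]

variable {m : Measure Z} {P P₁ P₂ : Measure (CountingMeasures Z 𝓑)}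

theorem IsPoissonProcess.map_apply (h : IsPoissonProcess m P) {A : Set Z} (hA : MeasurableSet A)
    (h0 : 0 < m A) (hfin : m A < ∞) :
    P.map (fun ω => ω.1 A) = (poissonMeasure (m A).toNNReal).map fun k : ℕ => (k : ℝ≥0∞) :=
  (h.2 1 (fun _ => A) (fun _ => hA) (fun _ _ hij => (hij (Subsingleton.elim _ _)).elim)
    fun _ => ⟨h0, hfin⟩).2 0

theorem IsPoissonProcess.lintegral_apply_lt_top (h : IsPoissonProcess m P) {A : Set Z}
    (hA : MeasurableSet A) (h0 : 0 < m A) (hfin : m A < ∞) : ∫⁻ ω, ω.1 A ∂P < ∞ := by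
  rw [← lintegral_map (f := fun x => x) measurable_id' (CountingMeasures.measurable_apply hA),
    h.map_apply hA h0 hfin, lintegral_map measurable_id' (by fun_prop)]
  exact lintegral_natCast_poissonMeasure_lt_top _

/-- The definition says nothing directly about null sets. Adjoining `A` to a disjoint `B` of
positive finite measure leaves the Poisson parameter unchanged, so the means of the counts of `A ∪
B` and `B` agree and are finite, which forces the mean count of `A` to vanish. Such a `B` exists
because `m ≠ 0`. -/
theorem IsPoissonProcess.ae_apply_eq_zero [SigmaFinite m] (hm : m ≠ 0) (h : IsPoissonProcess m P)
    {A : Set Z} (hA : MeasurableSet A) (h0 : m A = 0) : ∀ᵐ ω ∂P, ω.1 A = 0 := by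
  obtain ⟨n, hn⟩ := exists_pos_measure_of_cover (iUnion_spanningSets m) hm
  set B := spanningSets m n \ A with hB
  have hBm : MeasurableSet B := (measurableSet_spanningSets m n).diff hA
  have hmB : m B = m (spanningSets m n) := measure_sdiff_null h0
  have hmAB : m (A ∪ B) = m B := by
    rw [measure_union disjoint_sdiff_self_right hBm, h0, zero_add]
  have hB0 : 0 < m B := hmB ▸ hn
  have hBfin : m B < ∞ := hmB ▸ measure_spanningSets_lt_top m n
  have hadd : ∫⁻ ω, ω.1 (A ∪ B) ∂P = ∫⁻ ω, ω.1 A ∂P + ∫⁻ ω, ω.1 B ∂P := by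
    rw [← lintegral_add_left (CountingMeasures.measurable_apply hA)]
    exact lintegral_congr fun ω => measure_union disjoint_sdiff_self_right hBm
  have heq : ∫⁻ ω, ω.1 (A ∪ B) ∂P = ∫⁻ ω, ω.1 B ∂P := by
    rw [← lintegral_map (f := fun x => x) measurable_id'
        (CountingMeasures.measurable_apply (hA.union hBm)),
      ← lintegral_map (f := fun x => x) measurable_id' (CountingMeasures.measurable_apply hBm),
      h.map_apply (hA.union hBm) (hmAB ▸ hB0) (hmAB ▸ hBfin), h.map_apply hBm hB0 hBfin, hmAB]
  have hz : ∫⁻ ω, ω.1 A ∂P = 0 := by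
    have hlt := (h.lintegral_apply_lt_top hBm hB0 hBfin).ne
    rw [heq, eq_comm] at hadd
    exact (ENNReal.add_left_inj hlt).1 (hadd.trans (zero_add _).symm)
  exact (lintegral_eq_zero_iff (CountingMeasures.measurable_apply hA)).1 hz

theorem IsPoissonProcess.iIndepFun_apply (h : IsPoissonProcess m P) {D : Type*} {C : D → Set Z}
    (hC : ∀ d, MeasurableSet (C d)) (hd : Pairwise (Function.onFun Disjoint C))
    (hpos : ∀ d, 0 < m (C d)) (hfin : ∀ d, m (C d) < ∞) :
    iIndepFun (fun d (ω : CountingMeasures Z 𝓑) => ω.1 (C d)) P := by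
  rw [iIndepFun_iff_finset]
  intro s
  have := (h.2 s.card (fun i => C (s.equivFin.symm i)) (fun _ => hC _)
    (fun i j hij => hd fun h => hij (s.equivFin.symm.injective (Subtype.ext h)))
    fun _ => ⟨hpos _, hfin _⟩).1.precomp s.equivFin.injective
  simp only [Equiv.symm_apply_apply] at this
  exact this

/-- Cells of positive measure have prescribed independent laws, and the counts of null cells are
almost surely zero; `extend` fills in these zeros. -/
theorem IsPoissonProcess.map_eq_map_of_disjoint [SigmaFinite m] (hm : m ≠ 0)
    (h₁ : IsPoissonProcess m P₁) (h₂ : IsPoissonProcess m P₂) {D : Type*} [Countable D]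
    {C : D → Set Z} (hC : ∀ d, MeasurableSet (C d)) (hd : Pairwise (Function.onFun Disjoint C))
    (hfin : ∀ d, m (C d) < ∞) :
    P₁.map (fun ω d => ω.1 (C d)) = P₂.map fun ω d => ω.1 (C d) := by
  classical
  set pos : Set D := {d | 0 < m (C d)}
  set extend : (pos → ℝ≥0∞) → D → ℝ≥0∞ := fun x d => if hd : d ∈ pos then x ⟨d, hd⟩ else 0
  have hext : Measurable extend := measurable_pi_lambda _ fun d => by
    by_cases hd : d ∈ pos
    · simpa [extend, hd] using measurable_pi_apply _
    · simp [extend, hd]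
  have hmeas : Measurable fun (ω : CountingMeasures Z 𝓑) (d : pos) => ω.1 (C d) :=
    measurable_pi_lambda _ fun d => CountingMeasures.measurable_apply (hC d)
  have hjoint {P : Measure (CountingMeasures Z 𝓑)} (h : IsPoissonProcess m P) :
      P.map (fun ω d => ω.1 (C d)) = (Measure.infinitePi fun d : pos =>
        (poissonMeasure (m (C d)).toNNReal).map fun k : ℕ => (k : ℝ≥0∞)).map extend := by
    have hind := (h.iIndepFun_apply (C := fun d : pos => C d) (fun d => hC d)
      (fun i j hij => hd fun h => hij (Subtype.ext h)) (fun d => d.2)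
      (fun d => hfin d)).map_fun_eq_infinitePi_map
        (fun d : pos => CountingMeasures.measurable_apply (hC d))
    simp only [fun d : pos => h.map_apply (hC d) d.2 (hfin d)] at hind
    rw [← hind, Measure.map_map hext hmeas]
    refine Measure.map_congr ?_
    have hz : ∀ᵐ ω ∂P, ∀ d : (posᶜ : Set D), ω.1 (C d) = 0 := ae_all_iff.2 fun d =>
      h.ae_apply_eq_zero hm (hC d) (nonpos_iff_eq_zero.1 (not_lt.1 (show ¬ 0 < m (C d) from d.2)))
    filter_upwards [hz] with ω hω
    funext d
    by_cases hd : d ∈ pos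
    · simp [extend, hd]
    · simpa [extend, hd] using hω ⟨d, hd⟩
  rw [hjoint h₁, hjoint h₂]

/-- The Poisson process of a nonzero `σ`-finite intensity is unique. -/
theorem IsPoissonProcess.unique [SigmaFinite m] (hm : m ≠ 0)
    (h₁ : IsPoissonProcess m P₁) (h₂ : IsPoissonProcess m P₂) : P₁ = P₂ := by
  classical
  have := h₁.1
  refine CountingMeasures.measure_ext fun I => ?_
  -- The fibres of `c` are the atoms cut out by the sets of `I`, further split by the spanning index
  -- so that each has finite measure. They are countably many and disjoint, and each set of `I` is a
  -- union of them.
  set c : Z → ℕ × (I → Prop) := fun z => (spanningSetsIndex m z, fun A => z ∈ A.1.1)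
  have hc : Measurable c := (measurableSet_spanningSetsIndex m).prodMk
    (measurable_pi_lambda _ fun A => measurableSet_setOfPred.1 A.1.2)
  have hC (d : ℕ × (I → Prop)) : MeasurableSet (c ⁻¹' {d}) := hc (measurableSet_singleton d)
  have hfin (d : ℕ × (I → Prop)) : m (c ⁻¹' {d}) < ∞ := by
    refine (measure_mono fun z hz => ?_).trans_lt (measure_spanningSets_lt_top m d.1)
    have : spanningSetsIndex m z = d.1 := congrArg Prod.fst hz
    exact this ▸ mem_spanningSetsIndex m z
  set total : (ℕ × (I → Prop) → ℝ≥0∞) → I → ℝ≥0∞ :=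
    fun x A => ∑' d, Set.indicator {d | d.2 A} x d
  have htotal : Measurable total := measurable_pi_lambda _ fun A =>
    Measurable.tsum fun d => by
      by_cases hd : d.2 A
      · simpa [hd] using measurable_pi_apply d
      · simp [hd]
  have hsum (ω : CountingMeasures Z 𝓑) :
      (fun A : I => ω.1 A.1.1) = total fun d => ω.1 (c ⁻¹' {d}) := by
    funext A
    have h := Measure.tsum_indicator_apply_singleton (ω.1.map c) {d | d.2 A}
      (Set.to_countable _).measurableSet
    rw [Measure.map_apply hc (Set.to_countable _).measurableSet] at h
    refine h.symm.trans (tsum_congr fun d => ?_)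
    by_cases hd : d.2 A
    · simp [hd, Measure.map_apply hc]
    · simp [hd]
  have hmeas : Measurable fun (ω : CountingMeasures Z 𝓑) d => ω.1 (c ⁻¹' {d}) :=
    measurable_pi_lambda _ fun d => CountingMeasures.measurable_apply (hC d)
  rw [funext hsum]
  have h := congrArg (Measure.map total) (h₁.map_eq_map_of_disjoint hm h₂ hC
    (fun d e hde => Set.disjoint_left.2 fun z h1 h2 => hde (h1.symm.trans h2)) hfin)
  rwa [Measure.map_map htotal hmeas, Measure.map_map htotal hmeas] at h

end

/-- Checked on finite boxes: fixing the first family, the section of a box is again a box, and the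
measures of its sides are independent functions of the first family. It serves to separate marks
from positions in the sampling. -/
theorem MeasureTheory.Measure.map_zip_infinitePi_prod {ι : Type*} {α β : ι → Type*}
    [∀ i, MeasurableSpace (α i)] [∀ i, MeasurableSpace (β i)] (μ : ∀ i, Measure (α i))
    (ν : ∀ i, Measure (β i)) [∀ i, IsProbabilityMeasure (μ i)] [∀ i, IsProbabilityMeasure (ν i)] :
    ((Measure.infinitePi μ).prod (Measure.infinitePi ν)).map (fun p i => (p.1 i, p.2 i)) =
      Measure.infinitePi fun i => (μ i).prod (ν i) := by
  refine Measure.eq_infinitePi _ fun s t ht => ?_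
  have hz : Measurable fun (p : (∀ i, α i) × ∀ i, β i) i => (p.1 i, p.2 i) := by fun_prop
  have hbox : MeasurableSet ((s : Set ι).pi t) :=
    MeasurableSet.pi s.countable_toSet fun i _ => ht i
  rw [Measure.map_apply hz hbox, Measure.prod_apply (hz hbox)]
  have h1 (x : ∀ i, α i) : Measure.infinitePi ν
      (Prod.mk x ⁻¹' ((fun (p : (∀ i, α i) × ∀ i, β i) i => (p.1 i, p.2 i)) ⁻¹' (s : Set ι).pi t)) =
      ∏ i ∈ s, ν i (Prod.mk (x i) ⁻¹' t i) := by
    rw [← Measure.infinitePi_pi ν fun i _ => measurable_prodMk_left (ht i)]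
    rfl
  have hm (i : ι) : Measurable fun a => ν i (Prod.mk a ⁻¹' t i) :=
    measurable_measure_prodMk_left (ht i)
  simp only [h1]
  rw [lintegral_prod_eq_prod_lintegral_of_indepFun s (fun i (x : ∀ i, α i) => ν i (Prod.mk (x i) ⁻¹' t i))
    (iIndepFun_infinitePi (X := fun i a => ν i (Prod.mk a ⁻¹' t i)) hm) fun i => (hm i).comp (measurable_pi_apply i)]
  refine Finset.prod_congr rfl fun i _ => ?_
  rw [Measure.prod_apply (ht i)]
  exact (measurePreserving_eval_infinitePi μ i).lintegral_comp (hm i)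

/-! ### Images of configurations and of Poisson processes -/

section

variable {Z W : Type*} [MeasurableSpace Z] [MeasurableSpace W] {𝓑 : Bornology Z} {𝓒 : Bornology W}

theorem CountingMeasures.measurable_map (f : Z → W) (hf : Measurable f)
    (hb : ∀ B : Set W, @Bornology.IsBounded W 𝓒 B → @Bornology.IsBounded Z 𝓑 (f ⁻¹' B)) :
    Measurable (CountingMeasures.map (𝓑 := 𝓑) (𝓒 := 𝓒) f hf hb) :=
  Measurable.subtype_mk ((Measure.measurable_map f hf).comp measurable_subtype_coe)

theorem CountingMeasures.leftInverse_map {f : Z → W} {g : W → Z} (hf : Measurable f)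
    (hg : Measurable g)
    (hfb : ∀ B : Set W, @Bornology.IsBounded W 𝓒 B → @Bornology.IsBounded Z 𝓑 (f ⁻¹' B))
    (hgb : ∀ B : Set Z, @Bornology.IsBounded Z 𝓑 B → @Bornology.IsBounded W 𝓒 (g ⁻¹' B))
    (h : Function.LeftInverse g f) :
    Function.LeftInverse (CountingMeasures.map g hg hgb) (CountingMeasures.map f hf hfb) := by
  intro ω
  refine Subtype.ext ?_
  change (ω.1.map f).map g = ω.1
  rw [Measure.map_map hg hf, h.comp_eq_id, Measure.map_id]

/-- The image of a Poisson process under a measure preserving map is a Poisson process. -/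
theorem IsPoissonProcess.map {m : Measure Z} {m' : Measure W} {P : Measure (CountingMeasures Z 𝓑)}
    (h : IsPoissonProcess m P) {f : Z → W} (hf : MeasurePreserving f m m')
    (hb : ∀ B : Set W, @Bornology.IsBounded W 𝓒 B → @Bornology.IsBounded Z 𝓑 (f ⁻¹' B)) :
    IsPoissonProcess m' (P.map (CountingMeasures.map (𝓑 := 𝓑) (𝓒 := 𝓒) f hf.measurable hb)) := by
  have hF := CountingMeasures.measurable_map f hf.measurable hb
  have := h.1
  have hP := Measure.isProbabilityMeasure_map (μ := P) hF.aemeasurable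
  refine ⟨hP, fun n A hA hd hA' => ?_⟩
  have hm (i : Fin n) : m (f ⁻¹' A i) = m' (A i) := hf.measure_preimage (hA i).nullMeasurableSet
  have happ (i : Fin n) : (fun ω : CountingMeasures Z 𝓑 =>
      (CountingMeasures.map (𝓒 := 𝓒) f hf.measurable hb ω).1 (A i)) =
        fun ω => ω.1 (f ⁻¹' A i) :=
    funext fun ω => Measure.map_apply hf.measurable (hA i)
  have key := h.2 n (fun i => f ⁻¹' A i) (fun i => hf.measurable (hA i))
    (fun i j hij => (hd i j hij).preimage f) fun i => by rw [hm]; exact hA' i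
  have hev (i : Fin n) : Measurable fun ω : CountingMeasures W 𝓒 => ω.1 (A i) :=
    CountingMeasures.measurable_apply (hA i)
  have hmap (i : Fin n) : (P.map (CountingMeasures.map (𝓒 := 𝓒) f hf.measurable hb)).map
      (fun ω => ω.1 (A i)) = P.map fun ω => ω.1 (f ⁻¹' A i) := by
    rw [Measure.map_map (hev i) hF, ← happ]
    rfl
  refine ⟨?_, fun i => ?_⟩
  · have h1 := key.1
    rw [iIndepFun_iff_map_fun_eq_pi_map fun i => (hev i).aemeasurable,
      Measure.map_map (measurable_pi_lambda _ hev) hF]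
    rw [iIndepFun_iff_map_fun_eq_pi_map fun i => (CountingMeasures.measurable_apply
      (hf.measurable (hA i))).aemeasurable] at h1
    simp only [hmap]
    rw [← h1]
    congr 1
    funext ω i
    exact congrFun (happ i) ω
  · rw [hmap, key.2 i, hm]

/-- The two counts are independent, and a Poisson law of positive parameter charges both `1` and
`0`. -/
theorem IsPoissonProcess.pos_apply_ne_zero_and_apply_eq_zero {m : Measure Z}
    {P : Measure (CountingMeasures Z 𝓑)} (h : IsPoissonProcess m P) {A C : Set Z}
    (hA : MeasurableSet A) (hC : MeasurableSet C) (hAC : Disjoint A C)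
    (hA0 : 0 < m A) (hAfin : m A < ∞) (hC0 : 0 < m C) (hCfin : m C < ∞) :
    0 < P {ω | ω.1 A ≠ 0 ∧ ω.1 C = 0} := by
  have hind := (h.2 2 ![A, C] (by simp [Fin.forall_fin_two, hA, hC])
    (by simp [Fin.forall_fin_two, hAC, hAC.symm])
    (by simp [Fin.forall_fin_two, hA0, hC0, hAfin, hCfin])).1.indepFun
    (show (0 : Fin 2) ≠ 1 by decide)
  simp only [Matrix.cons_val_zero, Matrix.cons_val_one] at hind
  have hprod := hind.measure_inter_preimage_eq_mul {0}ᶜ {0}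
    (measurableSet_singleton 0).compl (measurableSet_singleton 0)
  change 0 < P ((fun ω => ω.1 A) ⁻¹' {0}ᶜ ∩ (fun ω => ω.1 C) ⁻¹' {0})
  rw [hprod, ← Measure.map_apply (CountingMeasures.measurable_apply hA)
      (measurableSet_singleton 0).compl,
    ← Measure.map_apply (CountingMeasures.measurable_apply hC) (measurableSet_singleton 0),
    h.map_apply hA hA0 hAfin, h.map_apply hC hC0 hCfin,
    Measure.map_apply (by fun_prop) (measurableSet_singleton 0).compl,
    Measure.map_apply (by fun_prop) (measurableSet_singleton 0)]
  have hpos {r : NNReal} (hr : 0 < r) (n : ℕ) {s : Set ℕ} (hn : n ∈ s) :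
      0 < poissonMeasure r s := by
    refine lt_of_lt_of_le ?_ (measure_mono (Set.singleton_subset_iff.2 hn))
    rw [poissonMeasure_singleton, ENNReal.ofReal_pos]
    positivity
  exact ENNReal.mul_pos
    (hpos (ENNReal.toNNReal_pos hA0.ne' hAfin.ne) 1 (by simp)).ne'
    (hpos (ENNReal.toNNReal_pos hC0.ne' hCfin.ne) 0 (by simp)).ne'

end

/-! ### The marked process sampled on unit cells -/

/-- The positions of points relative to the left end of their cell `[n, n + 1)`. -/
abbrev CellOffset : Type := Set.Ico (0 : ℝ) 1

/-- The uniform law on `[0, 1)`. -/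
noncomputable def cellLaw : Measure CellOffset := volume.comap Subtype.val

instance : IsProbabilityMeasure cellLaw :=
  ⟨by rw [cellLaw, comap_subtype_coe_apply measurableSet_Ico, Set.image_univ, Subtype.range_coe,
    Real.volume_Ico, sub_zero, ENNReal.ofReal_one]⟩

theorem map_intCast_add_cellOffset (n : ℤ) :
    cellLaw.map (fun u : CellOffset => (n : ℝ) + u) =
      volume.restrict (Set.Ico (n : ℝ) (n + 1)) := by
  have h : cellLaw.map (fun u : CellOffset => (u : ℝ)) =
      volume.restrict (Set.Ico 0 1) := map_comap_subtype_coe measurableSet_Ico _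
  have h2 := ((measurePreserving_add_left volume (n : ℝ)).restrict_preimage
    (s := Set.Ico (n : ℝ) (n + 1)) measurableSet_Ico).map_eq
  rw [Set.preimage_const_add_Ico, sub_self, add_sub_cancel_left, ← h,
    Measure.map_map (by fun_prop) (by fun_prop)] at h2
  exact h2

theorem sum_map_intCast_add_cellOffset :
    Measure.sum (fun n : ℤ => cellLaw.map fun u : CellOffset => (n : ℝ) + u) =
      volume := by
  simp only [map_intCast_add_cellOffset]
  rw [← Measure.restrict_iUnion (Set.pairwise_disjoint_Ico_intCast ℝ)
    fun _ => measurableSet_Ico, iUnion_Ico_intCast, Measure.restrict_univ]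

section

variable {K : Type*} [MeasurableSpace K]

/-- The marked point with relative position `y.1` in the cell `[n, n + 1)` and mark `y.2`. -/
def markedPoint (n : ℤ) (y : CellOffset × K) : ℝ × K := (n + y.1, y.2)

theorem measurable_markedPoint (n : ℤ) : Measurable (markedPoint (K := K) n) := by
  unfold markedPoint; fun_prop

theorem sum_map_markedPoint (ρ : Measure K) [IsProbabilityMeasure ρ] :
    Measure.sum (fun n : ℤ => (cellLaw.prod ρ).map (markedPoint n)) =
      volume.prod ρ := by
  rw [← sum_map_intCast_add_cellOffset, Measure.prod_sum_left]
  congr with n : 1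
  have := Measure.map_prod_map cellLaw ρ
    (f := fun u : CellOffset => (n : ℝ) + u) (g := id) (by fun_prop) measurable_id
  rw [Measure.map_id] at this
  rw [this]
  rfl

/-- The configuration with, for each `n`, `(w n).1` points in the cell `[n, n + 1)`, whose relative
positions and marks are the first terms of the sequence `(w n).2`. -/
noncomputable def markedConfig (w : ℤ → ℕ × (ℕ → CellOffset × K)) : MarkedConfig K :=
  ⟨pointMeasure markedPoint w, isCountingMeasure_pointMeasure _ _, fun B hBm hB => by
    rw [Bornology.isBounded_induced] at hB
    obtain ⟨R, hR⟩ := hB.subset_closedBall 0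
    -- Only cells meeting `[-R, R]` contribute; the extra `-1` is there because a point of cell `n`
    -- may lie almost one unit to the right of `n`.
    rw [pointMeasure_apply _ _ hBm, tsum_eq_sum (s := Finset.Icc (-⌈R⌉ - 1) ⌈R⌉)]
    · refine ENNReal.sum_lt_top.2 fun n _ => ENNReal.sum_lt_top.2 fun j _ => ?_
      exact (Set.indicator_le_self' (fun _ _ => zero_le) _).trans_lt (by simp)
    · intro n hn
      refine Finset.sum_eq_zero fun j _ => Set.indicator_of_notMem (fun hmem => hn ?_) _
      have h := hR (Set.mem_image_of_mem Prod.fst hmem)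
      have hu := ((w n).2 j).1.2
      simp only [markedPoint, Metric.mem_closedBall, dist_zero_right, Real.norm_eq_abs,
        abs_le] at h
      have hR' := Int.le_ceil R
      rw [Finset.mem_Icc]
      constructor
      · have : ((-⌈R⌉ - 1 : ℤ) : ℝ) ≤ n := by push_cast; linarith [hu.2, h.1]
        exact_mod_cast this
      · have : (n : ℝ) ≤ ⌈R⌉ := by linarith [hu.1, h.2]
        exact_mod_cast this⟩

theorem measurable_markedConfig : Measurable (markedConfig (K := K)) :=
  Measurable.subtype_mk (measurable_pointMeasure measurable_markedPoint)

theorem isPoissonProcess_map_markedConfig (ρ : Measure K) [IsProbabilityMeasure ρ] :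
    IsPoissonProcess (volume.prod ρ)
      ((sampleLaw ℤ (cellLaw.prod ρ)).map markedConfig) := by
  rw [← sum_map_markedPoint]
  exact isPoissonProcess_map_of_coe_eq_pointMeasure measurable_markedPoint _ fun _ => rfl

/-- Translation by one cell length preserves relative positions and marks, so it acts on samples as
a shift of the cell index. -/
theorem markedTranslationSuspension_markedConfig (w : ℤ → ℕ × (ℕ → CellOffset × K)) :
    markedTranslationSuspension K (markedConfig w) = markedConfig fun n => w (n - 1) := by
  have hT : Measurable (Prod.map translation (id : K → K)) :=
    measurable_translation.prodMap measurable_id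
  refine Subtype.ext (Measure.ext fun A hA => ?_)
  change (pointMeasure markedPoint w).map (Prod.map translation id) A =
    pointMeasure markedPoint (fun n => w (n - 1)) A
  rw [Measure.map_apply hT hA, pointMeasure_apply _ _ (hT hA), pointMeasure_apply _ _ hA]
  refine Eq.trans ?_ ((Equiv.addRight (1 : ℤ)).tsum_eq _)
  refine tsum_congr fun n => ?_
  simp only [Equiv.coe_addRight, add_sub_cancel_right]
  refine Finset.sum_congr rfl fun j _ => ?_
  have : markedPoint (n + 1) ((w n).2 j) =
      Prod.map translation id (markedPoint n ((w n).2 j)) := by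
    simp only [markedPoint, translation, Prod.map_apply, id]
    push_cast
    ring_nf
  rw [this]
  rfl

/-- Attach marks to a sample of relative positions. -/
def attachMarks (p : (ℤ → ℕ × (ℕ → CellOffset)) × (ℤ → ℕ → K)) :
    ℤ → ℕ × (ℕ → CellOffset × K) :=
  fun n => ((p.1 n).1, fun j => ((p.1 n).2 j, p.2 n j))

theorem measurable_attachMarks : Measurable (attachMarks (K := K)) := by
  unfold attachMarks; fun_prop

/-- The law of an array of independent marks of law `ρ`. -/
noncomputable def marksLaw (ρ : Measure K) : Measure (ℤ → ℕ → K) :=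
  Measure.infinitePi fun _ => Measure.infinitePi fun _ => ρ

instance (ρ : Measure K) [IsProbabilityMeasure ρ] : IsProbabilityMeasure (marksLaw ρ) := by
  unfold marksLaw; infer_instance

/-- Pairing independent i.i.d. families gives an i.i.d. family of pairs; this is applied first to
the points within a cell, then over the cells. It lets the marks be drawn separately, hence shared.
-/
theorem map_attachMarks (ρ : Measure K) [IsProbabilityMeasure ρ] :
    ((sampleLaw ℤ cellLaw).prod (marksLaw ρ)).map attachMarks =
      sampleLaw ℤ (cellLaw.prod ρ) := by
  set g : (ℕ × (ℕ → CellOffset)) × (ℕ → K) → ℕ × (ℕ → CellOffset × K) :=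
    fun q => (q.1.1, fun j => (q.1.2 j, q.2 j)) with hg
  have hgm : Measurable g := by fun_prop
  have hcell : (((poissonMeasure 1).prod (Measure.infinitePi fun _ : ℕ =>
      cellLaw)).prod (Measure.infinitePi fun _ : ℕ => ρ)).map g =
      (poissonMeasure 1).prod (Measure.infinitePi fun _ : ℕ =>
        cellLaw.prod ρ) := by
    have h := Measure.map_prod_map (poissonMeasure 1)
      ((Measure.infinitePi fun _ : ℕ => cellLaw).prod
        (Measure.infinitePi fun _ : ℕ => ρ)) measurable_id
      (show Measurable fun (p : (ℕ → CellOffset) × (ℕ → K)) j => (p.1 j, p.2 j) by fun_prop)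
    rw [Measure.map_id, Measure.map_zip_infinitePi_prod, ← Measure.prodAssoc_prod,
      Measure.map_map (by fun_prop) (by fun_prop)] at h
    exact h.symm
  have h := Measure.map_zip_infinitePi_prod
    (fun _ : ℤ => (poissonMeasure 1).prod (Measure.infinitePi fun _ : ℕ =>
      cellLaw)) (fun _ : ℤ => Measure.infinitePi fun _ : ℕ => ρ)
  have h' := congrArg (Measure.map fun x n => g (x n)) h
  rw [Measure.map_map (by fun_prop) (by fun_prop),
    Measure.infinitePi_map_pi _ (f := fun _ : ℤ => g) (fun _ => hgm)] at h'
  simp only [hcell] at h'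
  exact h'

end

/-! ### The joining with shared marks -/

section

variable {K : Type*} [MeasurableSpace K]

/-- The law of two configurations with independent positions and shared arrays of marks. -/
noncomputable def sharedMarksJoining (ρ : Measure K) : Measure (MarkedConfig K × MarkedConfig K) :=
  (((sampleLaw ℤ cellLaw).prod (sampleLaw ℤ cellLaw)).prod (marksLaw ρ)).map
    fun p => (markedConfig (attachMarks (p.1.1, p.2)), markedConfig (attachMarks (p.1.2, p.2)))

theorem measurable_sharedMarks : Measurable
    fun p : ((ℤ → ℕ × (ℕ → CellOffset)) × (ℤ → ℕ × (ℕ → CellOffset))) × (ℤ → ℕ → K) =>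
      (markedConfig (attachMarks (p.1.1, p.2)), markedConfig (attachMarks (p.1.2, p.2))) :=
  (measurable_markedConfig.comp (measurable_attachMarks.comp (by fun_prop))).prodMk
    (measurable_markedConfig.comp (measurable_attachMarks.comp (by fun_prop)))

instance (ρ : Measure K) [IsProbabilityMeasure ρ] : IsProbabilityMeasure (sharedMarksJoining ρ) :=
  Measure.isProbabilityMeasure_map measurable_sharedMarks.aemeasurable

theorem sharedMarksJoining_map_fst (ρ : Measure K) [IsProbabilityMeasure ρ] :
    (sharedMarksJoining ρ).map Prod.fst =
      (sampleLaw ℤ (cellLaw.prod ρ)).map markedConfig := by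
  rw [sharedMarksJoining, Measure.map_map measurable_fst measurable_sharedMarks, ← map_attachMarks,
    Measure.map_map measurable_markedConfig measurable_attachMarks]
  have h := Measure.map_prod_map ((sampleLaw ℤ cellLaw).prod
    (sampleLaw ℤ cellLaw)) (marksLaw ρ) measurable_fst measurable_id
  rw [Measure.map_id, Measure.map_fst_prod, measure_univ, one_smul] at h
  rw [h, Measure.map_map (measurable_markedConfig.comp measurable_attachMarks) (by fun_prop)]
  rfl

theorem sharedMarksJoining_map_snd (ρ : Measure K) [IsProbabilityMeasure ρ] :
    (sharedMarksJoining ρ).map Prod.snd =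
      (sampleLaw ℤ (cellLaw.prod ρ)).map markedConfig := by
  rw [sharedMarksJoining, Measure.map_map measurable_snd measurable_sharedMarks, ← map_attachMarks,
    Measure.map_map measurable_markedConfig measurable_attachMarks]
  have h := Measure.map_prod_map ((sampleLaw ℤ cellLaw).prod
    (sampleLaw ℤ cellLaw)) (marksLaw ρ) measurable_snd measurable_id
  rw [Measure.map_id, Measure.map_snd_prod, measure_univ, one_smul] at h
  rw [h, Measure.map_map (measurable_markedConfig.comp measurable_attachMarks) (by fun_prop)]
  rfl

theorem measurable_markedTranslationSuspension :
    Measurable (markedTranslationSuspension K) :=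
  CountingMeasures.measurable_map _ _ _

theorem measurable_forgetMarks : Measurable (forgetMarks K) :=
  CountingMeasures.measurable_map _ _ _

theorem measurePreserving_shift_infinitePi {α : Type*} [MeasurableSpace α] (μ : Measure α)
    [IsProbabilityMeasure μ] :
    MeasurePreserving (fun (x : ℤ → α) n => x (n - 1)) (Measure.infinitePi fun _ => μ)
      (Measure.infinitePi fun _ => μ) :=
  ⟨by fun_prop, Measure.map_infinitePi_infinitePi_of_inj (P := fun _ : ℤ => μ)
    (sub_left_injective (b := (1 : ℤ)))⟩

/-- Both suspensions act by the same index shift, so one shift of the common array of marks is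
compatible with both coordinates. -/
theorem measurePreserving_sharedMarksJoining (ρ : Measure K) [IsProbabilityMeasure ρ] :
    MeasurePreserving (Prod.map (markedTranslationSuspension K) (markedTranslationSuspension K))
      (sharedMarksJoining ρ) (sharedMarksJoining ρ) := by
  have hT := (measurable_markedTranslationSuspension (K := K)).prodMap
    (measurable_markedTranslationSuspension (K := K))
  refine ⟨hT, ?_⟩
  have h1 : MeasurePreserving (fun (x : ℤ → ℕ × (ℕ → CellOffset)) n => x (n - 1))
      (sampleLaw ℤ cellLaw) (sampleLaw ℤ cellLaw) := measurePreserving_shift_infinitePi _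
  have h2 : MeasurePreserving (fun (x : ℤ → ℕ → K) n => x (n - 1))
      (marksLaw ρ) (marksLaw ρ) := measurePreserving_shift_infinitePi _
  have h3 := (h1.prod h1).prod h2
  rw [sharedMarksJoining, Measure.map_map hT measurable_sharedMarks]
  conv_rhs => rw [← h3.map_eq, Measure.map_map measurable_sharedMarks h3.measurable]
  congr 1
  funext p
  simp only [Function.comp_apply, Prod.map_apply, markedTranslationSuspension_markedConfig]
  rfl

theorem forgetMarks_markedConfig_attachMarks (s : ℤ → ℕ × (ℕ → CellOffset)) (k k' : ℤ → ℕ → K) :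
    forgetMarks K (markedConfig (attachMarks (s, k))) =
      forgetMarks K (markedConfig (attachMarks (s, k'))) := by
  refine Subtype.ext ?_
  change (pointMeasure markedPoint _).map Prod.fst = (pointMeasure markedPoint _).map Prod.fst
  simp only [pointMeasure, Measure.map_sum measurable_fst.aemeasurable,
    Measure.map_dirac' measurable_fst]
  rfl

/-- The unmarked configurations do not depend on the marks, so the array can be frozen at an
arbitrary `k₀`; what remains is a function of two independent samples, one for each coordinate. -/
theorem map_forgetMarks_sharedMarksJoining (ρ : Measure K) [IsProbabilityMeasure ρ] :
    (sharedMarksJoining ρ).map (Prod.map (forgetMarks K) (forgetMarks K)) =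
      (((sampleLaw ℤ (cellLaw.prod ρ)).map markedConfig).map
        (forgetMarks K)).prod
      (((sampleLaw ℤ (cellLaw.prod ρ)).map markedConfig).map
        (forgetMarks K)) := by
  obtain ⟨k₀⟩ := nonempty_of_isProbabilityMeasure (marksLaw ρ)
  set G : (ℤ → ℕ × (ℕ → CellOffset)) → RealConfig :=
    fun s => forgetMarks K (markedConfig (attachMarks (s, k₀)))
  have hGm : Measurable G := measurable_forgetMarks.comp (measurable_markedConfig.comp
    (measurable_attachMarks.comp (by fun_prop)))
  have hmarg : ((sampleLaw ℤ (cellLaw.prod ρ)).map markedConfig).map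
      (forgetMarks K) = (sampleLaw ℤ cellLaw).map G := by
    rw [← map_attachMarks, Measure.map_map measurable_markedConfig measurable_attachMarks,
      Measure.map_map measurable_forgetMarks (measurable_markedConfig.comp measurable_attachMarks)]
    have h : forgetMarks K ∘ markedConfig ∘ attachMarks = G ∘ Prod.fst :=
      funext fun p => forgetMarks_markedConfig_attachMarks p.1 p.2 k₀
    rw [h, ← Measure.map_map hGm measurable_fst, Measure.map_fst_prod, measure_univ, one_smul]
  have hF := (measurable_forgetMarks (K := K)).prodMap (measurable_forgetMarks (K := K))
  rw [hmarg, Measure.map_prod_map _ _ hGm hGm, sharedMarksJoining,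
    Measure.map_map hF measurable_sharedMarks]
  have h : (Prod.map (forgetMarks K) (forgetMarks K) ∘ fun
      p : ((ℤ → ℕ × (ℕ → CellOffset)) × (ℤ → ℕ × (ℕ → CellOffset))) × (ℤ → ℕ → K) =>
      (markedConfig (attachMarks (p.1.1, p.2)), markedConfig (attachMarks (p.1.2, p.2)))) =
      Prod.map G G ∘ Prod.fst :=
    funext fun p => Prod.ext (forgetMarks_markedConfig_attachMarks p.1.1 p.2 k₀)
      (forgetMarks_markedConfig_attachMarks p.1.2 p.2 k₀)
  rw [h, ← Measure.map_map (hGm.prodMap hGm) measurable_fst, Measure.map_fst_prod, measure_univ,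
    one_smul]

theorem markedConfig_attachMarks_apply_Ico_prod (s : ℤ → ℕ × (ℕ → CellOffset)) (k : ℤ → ℕ → K)
    {B : Set K} (hB : MeasurableSet B) :
    (markedConfig (attachMarks (s, k))).1 (Set.Ico 0 1 ×ˢ B) =
      ∑ j ∈ Finset.range (s 0).1, B.indicator (1 : K → ℝ≥0∞) (k 0 j) := by
  refine (pointMeasure_apply _ _ (measurableSet_Ico.prod hB)).trans ?_
  rw [tsum_eq_single 0]
  · refine Finset.sum_congr rfl fun j _ => ?_
    by_cases hk : k 0 j ∈ B
    · rw [Set.indicator_of_mem hk, Set.indicator_of_mem]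
      · rfl
      · simp [markedPoint, attachMarks, hk]
    · rw [Set.indicator_of_notMem hk, Set.indicator_of_notMem]
      simp [markedPoint, attachMarks, hk]
  · intro n hn
    refine Finset.sum_eq_zero fun j _ => Set.indicator_of_notMem (fun hmem => hn ?_) _
    have hu := ((s n).2 j).2
    have h := hmem.1
    simp only [markedPoint, attachMarks, Set.mem_Ico] at h hu
    have h1 : (n : ℝ) < 1 := by linarith
    have h2 : (-1 : ℝ) < n := by linarith
    have h1' : n < 1 := by exact_mod_cast h1
    have h2' : -1 < n := by exact_mod_cast h2
    omega

/-- If cell `0` is nonempty, its first point carries the mark `k 0 0`, whatever the positions are.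
This entry is the one the two coordinates of the joining are sure to have in common when both are
nonempty there. -/
theorem markedConfig_attachMarks_mem_of_apply {s : ℤ → ℕ × (ℕ → CellOffset)} {k : ℤ → ℕ → K}
    {B : Set K} (hB : MeasurableSet B)
    (h1 : (markedConfig (attachMarks (s, k))).1 (Set.Ico 0 1 ×ˢ B) ≠ 0)
    (h2 : (markedConfig (attachMarks (s, k))).1 (Set.Ico 0 1 ×ˢ Bᶜ) = 0) : k 0 0 ∈ B := by
  rw [markedConfig_attachMarks_apply_Ico_prod s k hB] at h1
  rw [markedConfig_attachMarks_apply_Ico_prod s k hB.compl, Finset.sum_eq_zero_iff] at h2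
  have hN : 0 ∈ Finset.range (s 0).1 := by
    rw [Finset.mem_range, Nat.pos_iff_ne_zero]
    rintro h0
    simp [h0] at h1
  by_contra hk
  simpa [hk] using h2 0 hN

/-- Otherwise `ρ` takes only the values `0` and `1`, and on a standard Borel space such a
probability measure is a Dirac mass. -/
theorem exists_measurableSet_pos_of_ne_dirac [StandardBorelSpace K] (ρ : Measure K)
    [IsProbabilityMeasure ρ] (hρ : ∀ k : K, ρ ≠ Measure.dirac k) :
    ∃ B, MeasurableSet B ∧ 0 < ρ B ∧ 0 < ρ Bᶜ := by
  by_contra! h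
  have : IsZeroOneMeasure ρ := ⟨fun {B} hB => by
    rcases eq_or_ne (ρ B) 0 with h0 | h0
    · exact .inl h0
    · exact .inr ((prob_compl_eq_zero_iff hB).1
        (nonpos_iff_eq_zero.1 (h B hB (pos_iff_ne_zero.2 h0))))⟩
  obtain ⟨k, hk⟩ := IsZeroOneMeasure.exists_eq_dirac (μ := ρ)
  exact hρ k hk

/-- The event `E B` says that the strip over `[0, 1)` is nonempty and all its marks lie in `B`. The
rectangle `E B ×ˢ E Bᶜ` is impossible with shared marks, but has positive measure under the product.
-/
theorem sharedMarksJoining_ne_prod [StandardBorelSpace K] (ρ : Measure K)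
    [IsProbabilityMeasure ρ] (hρ : ∀ k : K, ρ ≠ Measure.dirac k)
    {Q : Measure (MarkedConfig K)} (hQ : IsPoissonProcess (volume.prod ρ) Q) :
    sharedMarksJoining ρ ≠ Q.prod Q := by
  obtain ⟨B, hB, hB0, hB1⟩ := exists_measurableSet_pos_of_ne_dirac ρ hρ
  have := hQ.1
  have hA {B : Set K} (hB : MeasurableSet B) :
      MeasurableSet (Set.Ico (0 : ℝ) 1 ×ˢ B) := measurableSet_Ico.prod hB
  have hm (B : Set K) : (volume : Measure ℝ).prod ρ (Set.Ico 0 1 ×ˢ B) = ρ B := by simp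
  have hpos {B : Set K} (hB : MeasurableSet B) (hB0 : 0 < ρ B) (hB1 : 0 < ρ Bᶜ) :
      0 < Q {ω | ω.1 (Set.Ico 0 1 ×ˢ B) ≠ 0 ∧ ω.1 (Set.Ico 0 1 ×ˢ Bᶜ) = 0} :=
    hQ.pos_apply_ne_zero_and_apply_eq_zero (hA hB) (hA hB.compl)
      (Set.disjoint_prod.2 (.inr disjoint_compl_right)) (hm B ▸ hB0) (hm B ▸ measure_lt_top ρ B)
      (hm Bᶜ ▸ hB1) (hm Bᶜ ▸ measure_lt_top ρ Bᶜ)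
  set E : Set K → Set (MarkedConfig K) :=
    fun B => {ω | ω.1 (Set.Ico 0 1 ×ˢ B) ≠ 0 ∧ ω.1 (Set.Ico 0 1 ×ˢ Bᶜ) = 0}
  have hEm {B : Set K} (hB : MeasurableSet B) : MeasurableSet (E B) :=
    ((CountingMeasures.measurable_apply (hA hB)) (measurableSet_singleton 0).compl).inter
      ((CountingMeasures.measurable_apply (hA hB.compl)) (measurableSet_singleton 0))
  intro h
  have h0 : sharedMarksJoining ρ (E B ×ˢ E Bᶜ) = 0 := by
    rw [sharedMarksJoining, Measure.map_apply measurable_sharedMarks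
      ((hEm hB).prod (hEm hB.compl))]
    refine (congrArg _ ?_).trans measure_empty
    refine Set.eq_empty_of_forall_notMem fun p hp => ?_
    exact markedConfig_attachMarks_mem_of_apply hB.compl hp.2.1 hp.2.2
      (markedConfig_attachMarks_mem_of_apply hB hp.1.1 hp.1.2)
  rw [h, Measure.prod_prod] at h0
  exact (ENNReal.mul_pos (hpos hB hB0 hB1).ne'
    (hpos hB.compl hB1 (by rwa [compl_compl])).ne').ne' h0

/-! ### Invertibility of the suspensions, equivariance, and the conclusion -/

theorem measurePreserving_translation : MeasurePreserving translation volume volume :=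
  measurePreserving_add_right volume 1

theorem isBounded_preimage_sub_one (B : Set ℝ) (hB : Bornology.IsBounded B) :
    Bornology.IsBounded ((fun x : ℝ => x - 1) ⁻¹' B) := by
  obtain ⟨R, hR⟩ := hB.subset_closedBall 0
  refine (Metric.isBounded_closedBall (x := (0 : ℝ)) (r := R + 1)).subset fun x hx => ?_
  have h := hR hx
  simp only [Metric.mem_closedBall, dist_zero_right, Real.norm_eq_abs, abs_le] at h ⊢
  constructor <;> linarith [h.1, h.2]

theorem exists_inverse_translationSuspension : ∃ S : RealConfig → RealConfig, Measurable S ∧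
    Function.LeftInverse S translationSuspension ∧
    Function.RightInverse S translationSuspension := by
  have hm : Measurable fun x : ℝ => x - 1 := by fun_prop
  exact ⟨CountingMeasures.map _ hm isBounded_preimage_sub_one,
    CountingMeasures.measurable_map _ _ _,
    CountingMeasures.leftInverse_map _ _ _ _ fun x => add_sub_cancel_right x 1,
    CountingMeasures.leftInverse_map _ _ _ _ fun x => sub_add_cancel x 1⟩

theorem exists_inverse_markedTranslationSuspension :
    ∃ S : MarkedConfig K → MarkedConfig K, Measurable S ∧
      Function.LeftInverse S (markedTranslationSuspension K) ∧
      Function.RightInverse S (markedTranslationSuspension K) := by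
  have hm : Measurable (Prod.map (fun x : ℝ => x - 1) (id : K → K)) := by fun_prop
  have hb (B : Set (ℝ × K)) (hB : @Bornology.IsBounded _ (Bornology.induced Prod.fst) B) :
      @Bornology.IsBounded _ (Bornology.induced Prod.fst)
        (Prod.map (fun x : ℝ => x - 1) (id : K → K) ⁻¹' B) := by
    rw [Bornology.isBounded_induced] at hB ⊢
    refine (isBounded_preimage_sub_one _ hB).subset ?_
    rintro _ ⟨p, hp, rfl⟩
    exact ⟨_, hp, rfl⟩
  exact ⟨CountingMeasures.map _ hm hb, CountingMeasures.measurable_map _ _ _,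
    CountingMeasures.leftInverse_map _ _ _ _ fun p => Prod.ext (add_sub_cancel_right p.1 1) rfl,
    CountingMeasures.leftInverse_map _ _ _ _ fun p => Prod.ext (sub_add_cancel p.1 1) rfl⟩

theorem forgetMarks_markedTranslationSuspension (ω : MarkedConfig K) :
    forgetMarks K (markedTranslationSuspension K ω) =
      translationSuspension (forgetMarks K ω) := by
  refine Subtype.ext ?_
  change (ω.1.map (Prod.map translation id)).map Prod.fst = (ω.1.map Prod.fst).map translation
  rw [Measure.map_map measurable_fst (measurable_translation.prodMap measurable_id),
    Measure.map_map measurable_translation measurable_fst]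
  rfl

end

theorem mainTheorem5 {K : Type*} [MeasurableSpace K] [StandardBorelSpace K]
    (ρ : Measure K) [IsProbabilityMeasure ρ] (hρ : ∀ k : K, ρ ≠ Measure.dirac k) :
    ∃ (P : Measure RealConfig) (Q : Measure (MarkedConfig K)),
      (∀ P' : Measure RealConfig, IsPoissonProcess volume P' ↔ P' = P) ∧
      (∀ Q' : Measure (MarkedConfig K), IsPoissonProcess (volume.prod ρ) Q' ↔ Q' = Q) ∧
      IsExtension Q (markedTranslationSuspension K) P translationSuspension (forgetMarks K) ∧
      ¬ IsConfined Q (markedTranslationSuspension K) P translationSuspension (forgetMarks K) := by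
  set Q : Measure (MarkedConfig K) :=
    (sampleLaw ℤ (cellLaw.prod ρ)).map markedConfig
  have hQ : IsPoissonProcess (volume.prod ρ) Q := isPoissonProcess_map_markedConfig ρ
  have hP : IsPoissonProcess volume (Q.map (forgetMarks K)) := hQ.map measurePreserving_fst _
  have hm : (volume : Measure ℝ) ≠ 0 := NeZero.ne _
  have hm' : (volume : Measure ℝ).prod ρ ≠ 0 := fun h => by
    have := congrArg (fun μ => μ (Set.univ ×ˢ Set.univ)) h
    rw [Measure.prod_prod] at this
    simp at this
  -- The translate of a Poisson process is Poisson of the translated intensity, here the same one,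
  -- so uniqueness gives invariance; likewise for `hTP`.
  have hTQ : MeasurePreserving (markedTranslationSuspension K) Q Q :=
    ⟨measurable_markedTranslationSuspension, (hQ.map
      (measurePreserving_translation.prod (MeasurePreserving.id ρ)) _).unique hm' hQ⟩
  have hTP : MeasurePreserving translationSuspension (Q.map (forgetMarks K))
      (Q.map (forgetMarks K)) :=
    ⟨CountingMeasures.measurable_map _ _ _,
      (hP.map measurePreserving_translation _).unique hm hP⟩
  refine ⟨Q.map (forgetMarks K), Q, fun P' => ⟨fun h => h.unique hm hP, fun h => h ▸ hP⟩,
    fun Q' => ⟨fun h => h.unique hm' hQ, fun h => h ▸ hQ⟩,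
    ⟨⟨hQ.1, hTQ, exists_inverse_markedTranslationSuspension⟩,
      ⟨hP.1, hTP, exists_inverse_translationSuspension⟩,
      ⟨measurable_forgetMarks, rfl⟩,
      ae_of_all _ forgetMarks_markedTranslationSuspension⟩, fun h => ?_⟩
  exact sharedMarksJoining_ne_prod ρ hρ hQ (h.2 _ inferInstance
    (measurePreserving_sharedMarksJoining ρ) (sharedMarksJoining_map_fst ρ)
    (sharedMarksJoining_map_snd ρ) (map_forgetMarks_sharedMarksJoining ρ))
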